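/- A digraph here is a finite connected directed graph (loops and multiple edges are allowed) in which each vertex has $k$ outgoing and $k$ incoming edges ("$k$-regular"), with adjacency matrix $A_{\mathcal D}$, where $(A_{\mathcal D})_{v,w}$ is the number of edges from $v$ to $w$. It is $m$-periodic if $m$ is the largest positive integer for which $V_{\mathcal D}=\coprod_{j\in\mathbb Z/m}V_j$ with every edge that starts in $V_j$ ending in $V_{j+1}$ (so $m=1$ means aperiodic). The eigenvalues of $A_{\mathcal D}$ of absolute value $k$ are called trivial, $L^2_0$ is the orthogonal complement of their eigenfunctions in $L^2(V_{\mathcal D})$, and $\rho(\mathcal D)$ is the spectral radius of $A_{\mathcal D}|_{L^2_0}$ (with $\rho(\mathcal D)=0$ if $L^2_0=0$). A digraph is $r$-normal if $A_{\mathcal D}$ is unitarily equivalent to a block-diagonal matrix with blocks of size at most $r\times r$, and a family of digraphs is almost-normal if all its members are $r$-normal for some fixed $r<\infty$. **Theorem.** Let $k\ge 2$ and $m\ge 1$. For any $\varepsilon>0$ there is no infinite almost-normal family of pairwise non-isomorphic $k$-regular $m$-periodic digraphs $\mathcal D$ with $\rho(\mathcal D)\le\sqrt k-\varepsilon$. 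-/

import Mathlib

/-- A directed graph on the vertex set `V`, with loops and multiple edges allowed: `mult v w` is the
number of edges from `v` to `w`. A simple digraph is the case in which all values are `0` or `1`. -/
structure MultiDigraph (V : Type*) where
  /-- the number of edges from the first vertex to the second -/
  mult : V → V → ℕ

/-- An `r`-normal complex matrix: it is unitarily equivalent to a block-diagonal matrix with blocks of
size at most `r × r`. The map `b` sends an index to the label of its block. -/
def IsRNormalMatrix {V : Type*} [Fintype V] [DecidableEq V] (r : ℕ) (M : Matrix V V ℂ) : Prop :=
  ∃ U ∈ Matrix.unitaryGroup V ℂ, ∃ b : V → ℕ,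
    (∀ c : ℕ, (Finset.univ.filter (fun v => b v = c)).card ≤ r) ∧
    ∀ v w : V, b v ≠ b w → (star U * M * U) v w = 0

namespace MultiDigraph

variable {V W : Type*}

/-- There is at least one edge from `v` to `w`. -/
def Adj (D : MultiDigraph V) (v w : V) : Prop := 0 < D.mult v w

/-- Isomorphism of digraphs: a bijection of the vertices that preserves the number of edges between
any two vertices. -/
structure Iso (D : MultiDigraph V) (D' : MultiDigraph W) where
  /-- the bijection of the vertices -/
  toEquiv : V ≃ W
  mult_eq : ∀ v w : V, D'.mult (toEquiv v) (toEquiv w) = D.mult v w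

/-- Each vertex has `k` outgoing and `k` incoming edges. -/
def IsRegular [Fintype V] (D : MultiDigraph V) (k : ℕ) : Prop :=
  (∀ v, ∑ w, D.mult v w = k) ∧ ∀ w, ∑ v, D.mult v w = k

/-- The digraph is non-empty, and connected when the directions of the edges are ignored. -/
def IsConnected (D : MultiDigraph V) : Prop :=
  Nonempty V ∧ ∀ v w : V, Relation.EqvGen D.Adj v w

/-- The vertices split into classes `V_j`, `j ∈ ℤ/p`, such that each edge that starts in `V_j` ends
in `V_{j+1}`. -/
def HasCyclicPartition (D : MultiDigraph V) (p : ℕ) : Prop :=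
  ∃ c : V → ZMod p, ∀ v w : V, D.Adj v w → c w = c v + 1

/-- `D` is `m`-periodic, in the exact sense: `m` is the largest positive number of classes of a cyclic
partition of `D`. So `m = 1` means that `D` is aperiodic. -/
def IsPeriodic (D : MultiDigraph V) (m : ℕ) : Prop :=
  IsGreatest {p : ℕ | 0 < p ∧ D.HasCyclicPartition p} m

/-- The adjacency matrix. -/
def adjMatrix (D : MultiDigraph V) : Matrix V V ℂ :=
  Matrix.of fun v w => (D.mult v w : ℂ)

/-- A digraph is `r`-normal if its adjacency matrix is. -/
def IsRNormal [Fintype V] [DecidableEq V] (D : MultiDigraph V) (r : ℕ) : Prop :=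
  IsRNormalMatrix r D.adjMatrix

/-- A family of digraphs is almost-normal if its members are `r`-normal for some fixed `r`. -/
def IsAlmostNormalFamily {ι : Type*} {V : ι → Type*} [∀ i, Fintype (V i)] [∀ i, DecidableEq (V i)]
    (D : ∀ i, MultiDigraph (V i)) : Prop :=
  ∃ r : ℕ, ∀ i, (D i).IsRNormal r

/-- The adjacency operator on `L²(V)`, `(A f)(v) = ∑_w A_{v,w} f(w)`. -/
noncomputable def adjOp [Fintype V] [DecidableEq V] (D : MultiDigraph V) :
    Module.End ℂ (EuclideanSpace ℂ V) :=
  Matrix.toEuclideanLin D.adjMatrix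

/-- The space `L²₀(V)` of a `k`-regular digraph: the orthogonal complement of the eigenfunctions of the
trivial eigenvalues, which are those of absolute value `k`. -/
noncomputable def L2zero [Fintype V] [DecidableEq V] (D : MultiDigraph V) (k : ℕ) :
    Submodule ℂ (EuclideanSpace ℂ V) :=
  (⨆ μ ∈ {μ : ℂ | ‖μ‖ = k}, D.adjOp.eigenspace μ)ᗮ

/-- The nontrivial spectral radius `ρ(D)` of a `k`-regular digraph: the largest absolute value of an
eigenvalue of the restriction of the adjacency operator to `L²₀(V)`, that is, of an eigenvalue with an
eigenfunction in `L²₀(V)` (and `0` if `L²₀(V) = 0`). -/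
noncomputable def rho [Fintype V] [DecidableEq V] (D : MultiDigraph V) (k : ℕ) : ℝ :=
  sSup {x : ℝ | ∃ μ : ℂ, ∃ f ∈ D.L2zero k, D.adjOp.HasEigenvector μ f ∧ x = ‖μ‖}

end MultiDigraph

/-! The proof computes the squared Frobenius norm of `A ^ n` in two ways. Its entries are natural
numbers, hence at most their squares, and each row sums to `k ^ n`, so the norm is at least `|V| * k
^ n` (`card_mul_pow_le`).

For the upper bound, the norm is unchanged on multiplying by the block-diagonalizing unitary `U`.
The columns of `U` in one block span an invariant subspace of dimension at most `r`, and different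
blocks are orthogonal. Trivial eigenspaces are one-dimensional and there are at most `m` trivial
eigenvalues, so at most `m` blocks contain a trivial eigenvector; their at most `m * r` columns
contribute at most `k ^ (2 * n)` each. On every other block all eigenvalues are at most `ρ` in
absolute value, so a column contributes at most `(C * (ρ + δ) ^ n) ^ 2`, with `C` depending only on
`k`, `δ`, `r` (`norm_pow_apply_le_of_mem_invariant`).

If `ρ + δ < √k`, some fixed `n` makes the latter at most `k ^ n / 2`, whence `|V| ≤ 2 * m * r * k ^
n`. Only finitely many `k`-regular digraphs are that small. -/

open Matrix in
theorem Matrix.sum_norm_sq_mul_unitary {V : Type*} [Fintype V] [DecidableEq V]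
    (B U : Matrix V V ℂ) (hU : U ∈ unitaryGroup V ℂ) :
    ∑ w, ∑ v, ‖(B * U) v w‖ ^ 2 = ∑ w, ∑ v, ‖B v w‖ ^ 2 := by
  have key : ∀ X : Matrix V V ℂ, ((∑ w, ∑ v, ‖X v w‖ ^ 2 : ℝ) : ℂ) = (Xᴴ * X).trace := by
    intro X
    simp only [Matrix.trace, Matrix.diag_apply, Matrix.mul_apply, Matrix.conjTranspose_apply]
    push_cast
    refine Finset.sum_congr rfl fun w _ => Finset.sum_congr rfl fun v _ => ?_
    rw [← Complex.conj_mul']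
    rfl
  have h := mem_unitaryGroup_iff.1 hU
  rw [star_eq_conjTranspose] at h
  have : (((∑ w, ∑ v, ‖(B * U) v w‖ ^ 2 : ℝ) : ℂ)) = ((∑ w, ∑ v, ‖B v w‖ ^ 2 : ℝ) : ℂ) := by
    rw [key, key, conjTranspose_mul, Matrix.mul_assoc, Matrix.trace_mul_comm, Matrix.mul_assoc,
      Matrix.mul_assoc, h, Matrix.mul_one]
  exact_mod_cast this

/-! ### Growth of powers on a small invariant subspace -/

/-- The constant in the bound for the powers of an operator on a vector which is killed by a product
of `n` linear factors. -/
noncomputable def powerBoundConst (K δ : ℝ) : ℕ → ℝ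
  | 0 => 0
  | n + 1 => 1 + 2 * K * powerBoundConst K δ n / δ

theorem powerBoundConst_nonneg {K δ : ℝ} (hK : 0 ≤ K) (hδ : 0 < δ) (n : ℕ) :
    0 ≤ powerBoundConst K δ n := by
  induction n with
  | zero => exact le_rfl
  | succ n ih => rw [powerBoundConst]; positivity

theorem powerBoundConst_mono {K δ : ℝ} (hK : 0 ≤ K) (hδ : 0 < δ) :
    Monotone (powerBoundConst K δ) := by
  refine monotone_nat_of_le_succ fun n => ?_
  induction n with
  | zero => exact powerBoundConst_nonneg hK hδ 1
  | succ n ih =>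
    rw [powerBoundConst, powerBoundConst]
    gcongr

/-- Put `y = (T - a) x`, which is killed by the remaining factors. In `T ^ (n + 1) x = a • T ^ n x +
T ^ n y` the second term is bounded by induction on the list, and the slack `δ` absorbs it; this
dictates the recursion for the constant. -/
theorem norm_pow_apply_le_of_list_prod_eq_zero {E : Type*} [NormedAddCommGroup E] [NormedSpace ℂ E]
    (T : Module.End ℂ E) {K ρ δ : ℝ} (hT : ∀ x, ‖T x‖ ≤ K * ‖x‖) (hρ : 0 ≤ ρ) (hρK : ρ ≤ K)
    (hδ : 0 < δ) (L : List ℂ) (hL : ∀ a ∈ L, ‖a‖ ≤ ρ) (x : E)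
    (hx : (L.map fun a => T - algebraMap ℂ (Module.End ℂ E) a).prod x = 0) (n : ℕ) :
    ‖(T ^ n) x‖ ≤ powerBoundConst K δ L.length * (ρ + δ) ^ n * ‖x‖ := by
  have hK : 0 ≤ K := hρ.trans hρK
  induction L generalizing x n with
  | nil =>
    have : x = 0 := by simpa using hx
    simp [this]
  | cons a L ih =>
    have ha : ‖a‖ ≤ ρ := hL a (by simp)
    set C := powerBoundConst K δ L.length with hC
    have hC0 : 0 ≤ C := powerBoundConst_nonneg hK hδ _
    have hC' : powerBoundConst K δ (a :: L).length = 1 + 2 * K * C / δ := rfl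
    set y := T x - a • x with hy
    have hcomm : Commute (T - algebraMap ℂ (Module.End ℂ E) a)
        (L.map fun a => T - algebraMap ℂ (Module.End ℂ E) a).prod := by
      refine Commute.list_prod_right _ _ fun z hz => ?_
      obtain ⟨c, -, rfl⟩ := List.mem_map.1 hz
      exact ((Commute.refl T).sub_left (Algebra.commutes a T)).sub_right
        (Algebra.commutes c _).symm
    have hyx : (T - algebraMap ℂ (Module.End ℂ E) a) x = y := by
      simp [hy, Module.algebraMap_end_apply]
    have hy0 : (L.map fun a => T - algebraMap ℂ (Module.End ℂ E) a).prod y = 0 := by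
      rw [List.map_cons, List.prod_cons, hcomm.eq, Module.End.mul_apply, hyx] at hx
      exact hx
    have hyn : ‖y‖ ≤ 2 * K * ‖x‖ := by
      calc ‖y‖ ≤ ‖T x‖ + ‖a • x‖ := norm_sub_le _ _
        _ ≤ K * ‖x‖ + K * ‖x‖ := by
          rw [norm_smul]
          gcongr
          · exact hT x
          · exact ha.trans hρK
        _ = 2 * K * ‖x‖ := by ring
    rw [hC']
    induction n with
    | zero =>
      have : 0 ≤ 2 * K * C / δ * ‖x‖ := by positivity
      simp only [pow_zero, Module.End.one_apply, mul_one]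
      linarith
    | succ n ihn =>
      have e : (T ^ (n + 1)) x = a • (T ^ n) x + (T ^ n) y := by
        rw [pow_succ, Module.End.mul_apply, hy, map_sub, map_smul]
        abel
      have h1 : ‖(T ^ n) y‖ ≤ C * (ρ + δ) ^ n * (2 * K * ‖x‖) :=
        (ih (fun a ha => hL a (List.mem_cons_of_mem _ ha)) y hy0 n).trans (by gcongr)
      calc ‖(T ^ (n + 1)) x‖ ≤ ‖a‖ * ‖(T ^ n) x‖ + ‖(T ^ n) y‖ := by
            rw [e, ← norm_smul]; exact norm_add_le _ _
        _ ≤ ρ * ((1 + 2 * K * C / δ) * (ρ + δ) ^ n * ‖x‖) + C * (ρ + δ) ^ n * (2 * K * ‖x‖) := by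
            gcongr
        _ = (1 + 2 * K * C / δ) * (ρ + δ) ^ (n + 1) * ‖x‖ - δ * (ρ + δ) ^ n * ‖x‖ := by
            field_simp
            ring
        _ ≤ _ := sub_le_self _ (by positivity)

/-- By Cayley–Hamilton, the restriction to `S` is killed by at most `r` linear factors, whose roots
are eigenvalues with eigenvectors in `S`. -/
theorem norm_pow_apply_le_of_mem_invariant {E : Type*} [NormedAddCommGroup E] [NormedSpace ℂ E]
    [FiniteDimensional ℂ E]
    (T : Module.End ℂ E) {K ρ δ : ℝ} (hT : ∀ x, ‖T x‖ ≤ K * ‖x‖) (hρ : 0 ≤ ρ) (hρK : ρ ≤ K)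
    (hδ : 0 < δ) (S : Submodule ℂ E) (hS : ∀ x ∈ S, T x ∈ S) {r : ℕ}
    (hr : Module.finrank ℂ S ≤ r) (hev : ∀ μ : ℂ, ∀ f ∈ S, T.HasEigenvector μ f → ‖μ‖ ≤ ρ)
    (x : E) (hx : x ∈ S) (n : ℕ) :
    ‖(T ^ n) x‖ ≤ powerBoundConst K δ r * (ρ + δ) ^ n * ‖x‖ := by
  have hK : 0 ≤ K := hρ.trans hρK
  let R : Module.End ℂ S := T.restrict hS
  have hsplit := IsAlgClosed.splits R.charpoly
  -- The roots are ordered into a list because the product of the factors lives in a noncommutative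
  -- ring.
  obtain ⟨L, hL⟩ := Quot.exists_rep R.charpoly.roots
  have hlen : L.length ≤ r := by
    have h1 : L.length = Multiset.card R.charpoly.roots := by rw [← hL]; rfl
    rw [h1]
    exact (Polynomial.card_roots' _).trans ((LinearMap.charpoly_natDegree R).le.trans hr)
  have hLρ : ∀ a ∈ L, ‖a‖ ≤ ρ := by
    intro a ha
    have h1 : a ∈ R.charpoly.roots := by rw [← hL]; exact ha
    have h2 : R.HasEigenvalue a :=
      (Module.End.hasEigenvalue_iff_isRoot_charpoly R a).2 (Polynomial.isRoot_of_mem_roots h1)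
    obtain ⟨v, hv⟩ := h2.exists_hasEigenvector
    refine hev a v v.2 ((Module.End.hasEigenvector_iff).2 ⟨?_, by simpa using hv.2⟩)
    rw [Module.End.mem_eigenspace_iff]
    exact congrArg Subtype.val hv.apply_eq_smul
  have hp : R.charpoly = (L.map fun a => Polynomial.X - Polynomial.C a).prod := by
    rw [hsplit.eq_prod_roots_of_monic (LinearMap.charpoly_monic R), ← hL]
    rfl
  have hkill : (L.map fun a => R - algebraMap ℂ (Module.End ℂ S) a).prod = 0 := by
    have := LinearMap.aeval_self_charpoly R
    rw [hp, map_list_prod, List.map_map] at this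
    simpa [Function.comp_def] using this
  have hcoe : ∀ (L : List ℂ) (z : S),
      (L.map fun a => T - algebraMap ℂ (Module.End ℂ E) a).prod (z : E)
        = ((L.map fun a => R - algebraMap ℂ (Module.End ℂ S) a).prod z : S) := by
    intro L
    induction L with
    | nil => intro z; simp
    | cons a L ih =>
      intro z
      simp only [List.map_cons, List.prod_cons, Module.End.mul_apply, ih]
      simp [Module.algebraMap_end_apply, R]
  have h0 := hcoe L ⟨x, hx⟩
  rw [hkill] at h0
  refine (norm_pow_apply_le_of_list_prod_eq_zero T hT hρ hρK hδ L hLρ x (by simpa using h0) n).trans ?_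
  have := powerBoundConst_mono hK hδ hlen
  gcongr

/-! ### Trivial eigenfunctions and their orthogonal complement -/

namespace MultiDigraph

variable {V : Type*}

theorem adjOp_apply [Fintype V] [DecidableEq V] (D : MultiDigraph V) (f : EuclideanSpace ℂ V) (v : V) :
    D.adjOp f v = ∑ w, (D.mult v w : ℂ) * f w := by
  simp [adjOp, adjMatrix, Matrix.toLpLin_apply, Matrix.mulVec, dotProduct]

/-- A variance identity: `D.adjOp f v` is `k` times the average of `f` over the out-neighbours of
`v`. Nonnegativity gives the operator bound `k`, and the equality case describes the trivial
eigenfunctions. -/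
theorem IsRegular.sum_mult_norm_sub_sq [Fintype V] [DecidableEq V] {D : MultiDigraph V} {k : ℕ}
    (hD : D.IsRegular k) (f : EuclideanSpace ℂ V) :
    ∑ v, ∑ w, (D.mult v w : ℝ) * ‖k * f w - D.adjOp f v‖ ^ 2
      = k * (k ^ 2 * ‖f‖ ^ 2 - ‖D.adjOp f‖ ^ 2) := by
  set g := D.adjOp f with hg
  have hexp : ∀ v w, (D.mult v w : ℝ) * ‖k * f w - g v‖ ^ 2 =
      k ^ 2 * ((D.mult v w : ℝ) * ‖f w‖ ^ 2) + (D.mult v w : ℝ) * ‖g v‖ ^ 2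
        - 2 * k * (((D.mult v w : ℂ) * f w) * (starRingEnd ℂ) (g v)).re := by
    intro v w
    rw [← Complex.normSq_eq_norm_sq, ← Complex.normSq_eq_norm_sq, ← Complex.normSq_eq_norm_sq]
    simp only [Complex.normSq_apply, Complex.sub_re, Complex.sub_im, Complex.mul_re, Complex.mul_im,
      Complex.natCast_re, Complex.natCast_im, Complex.conj_re, Complex.conj_im]
    ring
  simp only [hexp, Finset.sum_sub_distrib, Finset.sum_add_distrib, ← Finset.mul_sum]
  have h1 : ∑ v, ∑ w, (D.mult v w : ℝ) * ‖f w‖ ^ 2 = k * ‖f‖ ^ 2 := by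
    rw [Finset.sum_comm, EuclideanSpace.norm_sq_eq, Finset.mul_sum]
    refine Finset.sum_congr rfl fun w _ => ?_
    rw [← Finset.sum_mul, ← Nat.cast_sum, hD.2 w]
  have h2 : ∑ v, ∑ w, (D.mult v w : ℝ) * ‖g v‖ ^ 2 = k * ‖g‖ ^ 2 := by
    rw [EuclideanSpace.norm_sq_eq, Finset.mul_sum]
    refine Finset.sum_congr rfl fun v _ => ?_
    rw [← Finset.sum_mul, ← Nat.cast_sum, hD.1 v]
  have h3 : ∑ v, ∑ w, (((D.mult v w : ℂ) * f w) * (starRingEnd ℂ) (g v)).re = ‖g‖ ^ 2 := by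
    rw [EuclideanSpace.norm_sq_eq]
    refine Finset.sum_congr rfl fun v _ => ?_
    rw [← Complex.re_sum, ← Finset.sum_mul, ← adjOp_apply, ← hg, Complex.mul_conj,
      Complex.ofReal_re, Complex.normSq_eq_norm_sq]
  rw [h1, h3]
  simp only at h2 ⊢
  rw [h2]
  ring

theorem IsRegular.norm_adjOp_le [Fintype V] [DecidableEq V] {D : MultiDigraph V} {k : ℕ}
    (hD : D.IsRegular k) (hk : 0 < k) (f : EuclideanSpace ℂ V) : ‖D.adjOp f‖ ≤ k * ‖f‖ := by
  have h := hD.sum_mult_norm_sub_sq f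
  have h0 : 0 ≤ ∑ v, ∑ w, (D.mult v w : ℝ) * ‖k * f w - D.adjOp f v‖ ^ 2 := by positivity
  rw [h] at h0
  have hk' : (0 : ℝ) < k := by exact_mod_cast hk
  have := nonneg_of_mul_nonneg_right h0 hk'
  refine le_of_sq_le_sq ?_ (by positivity)
  rw [mul_pow]; linarith

theorem IsRegular.apply_eq_of_adj [Fintype V] [DecidableEq V] {D : MultiDigraph V} {k : ℕ}
    (hD : D.IsRegular k) {μ : ℂ} (hμ : ‖μ‖ = k) {f : EuclideanSpace ℂ V}
    (hf : D.adjOp f = μ • f) {v w : V} (hvw : D.Adj v w) : k * f w = μ * f v := by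
  have h := hD.sum_mult_norm_sub_sq f
  rw [hf, norm_smul, hμ, mul_pow, sub_self, mul_zero,
    Finset.sum_eq_zero_iff_of_nonneg fun _ _ => by positivity] at h
  have h1 := h v (Finset.mem_univ v)
  rw [Finset.sum_eq_zero_iff_of_nonneg fun _ _ => by positivity] at h1
  have h2 := h1 w (Finset.mem_univ w)
  have h3 : (D.mult v w : ℝ) ≠ 0 := by exact_mod_cast Nat.pos_iff_ne_zero.1 hvw
  simpa [h3, sub_eq_zero] using h2

/-- Since `f` is multiplied by `μ / k`, of absolute value 1, along each edge, going backwards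
multiplies it by the conjugate. Thus `f` is also an eigenfunction of the adjoint, which makes it
orthogonal to all eigenfunctions of other eigenvalues. -/
theorem IsRegular.sum_mult_apply_of_trivial [Fintype V] [DecidableEq V] {D : MultiDigraph V} {k : ℕ}
    (hD : D.IsRegular k) (hk : 0 < k) {μ : ℂ} (hμ : ‖μ‖ = k) {f : EuclideanSpace ℂ V}
    (hf : D.adjOp f = μ • f) (w : V) :
    ∑ v, (D.mult v w : ℂ) * f v = (starRingEnd ℂ) μ * f w := by
  have hk' : (k : ℂ) ≠ 0 := by exact_mod_cast hk.ne'
  have hμμ : (starRingEnd ℂ) μ * μ = k ^ 2 := by rw [Complex.conj_mul', hμ]; simp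
  have hterm : ∀ v, (D.mult v w : ℂ) * f v = (D.mult v w : ℂ) * ((starRingEnd ℂ) μ * f w / k) := by
    intro v
    rcases Nat.eq_zero_or_pos (D.mult v w) with h | h
    · simp [h]
    · congr 1
      rw [eq_div_iff hk']
      apply mul_left_cancel₀ hk'
      linear_combination (-f v) * hμμ - (starRingEnd ℂ) μ * hD.apply_eq_of_adj hμ hf h
  rw [Finset.sum_congr rfl fun v _ => hterm v, ← Finset.sum_mul, ← Nat.cast_sum, hD.2 w]
  field_simp

theorem IsRegular.inner_eq_zero_of_trivial [Fintype V] [DecidableEq V] {D : MultiDigraph V} {k : ℕ}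
    (hD : D.IsRegular k) (hk : 0 < k) {μ ν : ℂ} (hμ : ‖μ‖ = k) (hν : ν ≠ μ)
    {f g : EuclideanSpace ℂ V} (hf : D.adjOp f = μ • f) (hg : D.adjOp g = ν • g) :
    inner ℂ f g = 0 := by
  have h1 : inner ℂ f (D.adjOp g) = μ * inner ℂ f g := by
    simp only [PiLp.inner_apply, RCLike.inner_apply, adjOp_apply, Finset.sum_mul]
    rw [Finset.sum_comm, Finset.mul_sum]
    refine Finset.sum_congr rfl fun w _ => ?_
    have := congrArg (starRingEnd ℂ) (hD.sum_mult_apply_of_trivial hk hμ hf w)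
    simp only [map_sum, map_mul, map_natCast, Complex.conj_conj] at this
    calc _ = g w * ∑ v, (D.mult v w : ℂ) * (starRingEnd ℂ) (f v) := by
          rw [Finset.mul_sum]; exact Finset.sum_congr rfl fun v _ => by ring
      _ = _ := by rw [this]; ring
  rw [hg, inner_smul_right] at h1
  have : (ν - μ) * inner ℂ f g = 0 := by rw [sub_mul, h1, sub_self]
  exact (mul_eq_zero.1 this).resolve_left (sub_ne_zero.2 hν)

theorem IsRegular.norm_eigenvalue_le [Fintype V] [DecidableEq V] {D : MultiDigraph V} {k : ℕ}
    (hD : D.IsRegular k) (hk : 0 < k) {μ : ℂ} {f : EuclideanSpace ℂ V}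
    (hf : D.adjOp.HasEigenvector μ f) : ‖μ‖ ≤ k := by
  have h := hD.norm_adjOp_le hk f
  rw [hf.apply_eq_smul, norm_smul] at h
  exact le_of_mul_le_mul_right h (norm_pos_iff.2 hf.2)

/-- An eigenvector of a nontrivial eigenvalue lies in `L2zero` automatically, so blocks need not be
compatible with that subspace. -/
theorem IsRegular.norm_eigenvalue_le_rho [Fintype V] [DecidableEq V] {D : MultiDigraph V} {k : ℕ}
    (hD : D.IsRegular k) (hk : 0 < k) {μ : ℂ} (hμ : ‖μ‖ ≠ k) {f : EuclideanSpace ℂ V}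
    (hf : D.adjOp.HasEigenvector μ f) : ‖μ‖ ≤ D.rho k := by
  refine le_csSup ⟨k, ?_⟩ ⟨μ, f, ?_, hf, rfl⟩
  · rintro x ⟨ν, g, -, hg, rfl⟩
    exact hD.norm_eigenvalue_le hk hg
  · refine (Submodule.isOrtho_iff_le.1 (Submodule.IsOrtho.symm ?_)) (Submodule.mem_span_singleton_self f)
    simp only [Submodule.isOrtho_iSup_left]
    intro ν hν g hg
    rw [Submodule.mem_orthogonal_singleton_iff_inner_left]
    refine hD.inner_eq_zero_of_trivial hk hν ?_ (Module.End.mem_eigenspace_iff.1 hg) hf.apply_eq_smul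
    rintro rfl
    exact hμ hν

theorem rho_nonneg [Fintype V] [DecidableEq V] (D : MultiDigraph V) (k : ℕ) : 0 ≤ D.rho k := by
  refine Real.sSup_nonneg ?_
  rintro x ⟨μ, f, -, -, rfl⟩
  exact norm_nonneg _

/-! ### Trivial eigenvalues and the period -/

/-- The group of all `ζ` for which there is a nowhere vanishing function that gets multiplied by `ζ`
along each edge. -/
def periodGroup (D : MultiDigraph V) : Subgroup ℂˣ where
  carrier := {ζ | ∃ c : V → ℂˣ, ∀ v w, D.Adj v w → c w = ζ * c v}
  one_mem' := ⟨1, fun _ _ _ => by simp⟩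
  mul_mem' := by
    rintro a b ⟨c, hc⟩ ⟨d, hd⟩
    exact ⟨c * d, fun v w h => by simp only [Pi.mul_apply, hc v w h, hd v w h]; exact mul_mul_mul_comm _ _ _ _⟩
  inv_mem' := by
    rintro a ⟨c, hc⟩
    exact ⟨c⁻¹, fun v w h => by simp only [Pi.inv_apply, hc v w h]; exact mul_inv _ _⟩

theorem IsRegular.finite_periodGroup [Fintype V] [DecidableEq V] [Nonempty V] {D : MultiDigraph V}
    {k : ℕ} (hD : D.IsRegular k) (hk : 0 < k) : Finite D.periodGroup := by
  have hk' : (k : ℂ) ≠ 0 := by exact_mod_cast hk.ne'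
  have hev : ∀ ζ : D.periodGroup, D.adjOp.HasEigenvalue (k * (ζ : ℂˣ) : ℂ) := by
    rintro ⟨ζ, c, hc⟩
    refine Module.End.hasEigenvalue_of_hasEigenvector (x := WithLp.toLp 2 fun v => (c v : ℂ))
      ⟨Module.End.mem_eigenspace_iff.2 ?_, ?_⟩
    · ext v
      rw [adjOp_apply]
      have : ∀ w, (D.mult v w : ℂ) * (c w : ℂ) = (D.mult v w : ℂ) * (ζ * c v) := by
        intro w
        rcases Nat.eq_zero_or_pos (D.mult v w) with h | h
        · simp [h]
        · rw [hc v w h, Units.val_mul]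
      simp only [this, ← Finset.sum_mul, ← Nat.cast_sum, hD.1 v]
      simp [mul_assoc]
    · intro h
      obtain ⟨v⟩ := ‹Nonempty V›
      exact (c v).ne_zero (by simpa using congrFun (congrArg WithLp.ofLp h) v)
  refine Finite.of_injective (β := D.adjOp.Eigenvalues) (fun ζ => ⟨_, hev ζ⟩) ?_
  intro a b hab
  have := mul_left_cancel₀ hk' (congrArg Subtype.val hab)
  exact Subtype.ext (Units.ext this)

/-- A finite group of units of a field is cyclic. By connectedness, the function of a generator `ζ`
takes only values `ζ ^ i * c v₀`, and the exponent modulo the order of `ζ` labels the classes. -/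
theorem IsConnected.hasCyclicPartition_card_periodGroup {D : MultiDigraph V} (hconn : D.IsConnected)
    [Finite D.periodGroup] : D.HasCyclicPartition (Nat.card D.periodGroup) := by
  obtain ⟨⟨v₀⟩, hc⟩ := hconn
  obtain ⟨⟨ζ, c, hcζ⟩, hgen⟩ := IsCyclic.exists_ofOrder_eq_natCard (α := D.periodGroup)
  have hord : orderOf ζ = Nat.card D.periodGroup := by
    rw [← hgen]; exact (Subgroup.orderOf_mk ζ _).symm
  have hrel : ∀ v w, Relation.EqvGen D.Adj v w → ∃ i : ℤ, c w = ζ ^ i * c v := by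
    intro v w h
    induction h with
    | rel v w h => exact ⟨1, by rw [zpow_one]; exact hcζ v w h⟩
    | refl v => exact ⟨0, by simp⟩
    | symm v w _ ih => obtain ⟨i, hi⟩ := ih; exact ⟨-i, by rw [hi, zpow_neg, inv_mul_cancel_left]⟩
    | trans u v w _ _ ih₁ ih₂ =>
      obtain ⟨i, hi⟩ := ih₁
      obtain ⟨j, hj⟩ := ih₂
      exact ⟨j + i, by rw [hj, hi, zpow_add, mul_assoc]⟩
  choose i hi using fun v => hrel v₀ v (hc v₀ v)
  refine ⟨fun v => (i v : ZMod _), fun v w h => ?_⟩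
  have h1 := hcζ v w h
  rw [hi w, hi v, ← mul_assoc, ← zpow_one_add] at h1
  have h2 := zpow_eq_zpow_iff_modEq.1 (mul_right_cancel h1)
  rw [hord] at h2
  have h3 := (ZMod.intCast_eq_intCast_iff _ _ _).2 h2
  push_cast at h3
  rw [add_comm]
  exact h3

theorem IsPeriodic.card_periodGroup_le {D : MultiDigraph V} {m : ℕ} (hm : D.IsPeriodic m)
    (hconn : D.IsConnected) [Finite D.periodGroup] : Nat.card D.periodGroup ≤ m :=
  hm.2 ⟨Nat.card_pos, hconn.hasCyclicPartition_card_periodGroup⟩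

theorem IsConnected.eq_zero_of_apply_eq_zero {D : MultiDigraph V} (hconn : D.IsConnected)
    {ζ : ℂ} (hζ : ζ ≠ 0) {f : V → ℂ} (hf : ∀ v w, D.Adj v w → f w = ζ * f v)
    {v : V} (hv : f v = 0) (w : V) : f w = 0 := by
  have : ∀ v w, Relation.EqvGen D.Adj v w → (f v = 0 ↔ f w = 0) := by
    intro v w h
    induction h with
    | rel v w h => simp [hf v w h, hζ]
    | refl v => exact Iff.rfl
    | symm v w _ ih => exact ih.symm
    | trans u v w _ _ ih₁ ih₂ => exact ih₁.trans ih₂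
  exact (this v w (hconn.2 v w)).1 hv

theorem IsRegular.apply_eq_mul_of_adj [Fintype V] [DecidableEq V] {D : MultiDigraph V} {k : ℕ}
    (hD : D.IsRegular k) (hk : 0 < k) {μ : ℂ} (hμ : ‖μ‖ = k) {f : EuclideanSpace ℂ V}
    (hf : D.adjOp f = μ • f) {v w : V} (hvw : D.Adj v w) : f w = μ / k * f v := by
  have hk' : (k : ℂ) ≠ 0 := by exact_mod_cast hk.ne'
  have := hD.apply_eq_of_adj hμ hf hvw
  field_simp
  linear_combination this

theorem trivial_div_ne_zero {k : ℕ} (hk : 0 < k) {μ : ℂ} (hμ : ‖μ‖ = k) : μ / k ≠ 0 := by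
  have hk' : (k : ℂ) ≠ 0 := by exact_mod_cast hk.ne'
  refine div_ne_zero (fun h => ?_) hk'
  rw [h, norm_zero] at hμ
  exact hk.ne (by exact_mod_cast hμ)

theorem IsRegular.mk0_mem_periodGroup [Fintype V] [DecidableEq V] {D : MultiDigraph V} {k : ℕ}
    (hD : D.IsRegular k) (hk : 0 < k) (hconn : D.IsConnected) {μ : ℂ} (hμ : ‖μ‖ = k)
    {f : EuclideanSpace ℂ V} (hf : D.adjOp.HasEigenvector μ f) :
    Units.mk0 (μ / k) (trivial_div_ne_zero hk hμ) ∈ D.periodGroup := by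
  have hadj := fun v w => hD.apply_eq_mul_of_adj (v := v) (w := w) hk hμ hf.apply_eq_smul
  have hne : ∀ v, f v ≠ 0 := fun v hv => hf.2 (PiLp.ext fun w =>
    hconn.eq_zero_of_apply_eq_zero (trivial_div_ne_zero hk hμ) hadj hv w)
  exact ⟨fun v => Units.mk0 (f v) (hne v), fun v w h => Units.ext (by simpa using hadj v w h)⟩

/-- A trivial eigenfunction is determined by its value at one vertex, so `f` and `g` are
proportional. -/
theorem IsRegular.inner_ne_zero_of_trivial [Fintype V] [DecidableEq V] {D : MultiDigraph V} {k : ℕ}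
    (hD : D.IsRegular k) (hk : 0 < k) (hconn : D.IsConnected) {μ : ℂ} (hμ : ‖μ‖ = k)
    {f g : EuclideanSpace ℂ V} (hf : D.adjOp.HasEigenvector μ f) (hg : D.adjOp.HasEigenvector μ g) :
    inner ℂ f g ≠ 0 := by
  have h0 := trivial_div_ne_zero hk hμ
  obtain ⟨v₀⟩ := hconn.1
  have hf0 : f v₀ ≠ 0 := fun hv => hf.2 (PiLp.ext fun w => hconn.eq_zero_of_apply_eq_zero h0
    (fun v w => hD.apply_eq_mul_of_adj hk hμ hf.apply_eq_smul) hv w)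
  have hcomb : f v₀ • g = g v₀ • f := by
    refine PiLp.ext fun w => ?_
    have := hconn.eq_zero_of_apply_eq_zero h0 (f := fun w => f v₀ * g w - g v₀ * f w) (v := v₀)
      (fun v w h => by
        rw [hD.apply_eq_mul_of_adj hk hμ hf.apply_eq_smul h,
          hD.apply_eq_mul_of_adj hk hμ hg.apply_eq_smul h]
        ring) (sub_eq_zero.2 (mul_comm _ _)) w
    simpa [sub_eq_zero] using this
  intro hinner
  have h1 : g v₀ * inner ℂ f f = 0 := by
    rw [← inner_smul_right, ← hcomb, inner_smul_right, hinner, mul_zero]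
  have hg0 : g v₀ = 0 := (mul_eq_zero.1 h1).resolve_right (inner_self_ne_zero.2 hf.2)
  rw [hg0, zero_smul, smul_eq_zero] at hcomb
  exact hcomb.elim hf0 hg.2

/-! ### Two estimates of the Frobenius norm of a power -/

theorem IsRegular.row_sum_pow [Fintype V] [DecidableEq V] {D : MultiDigraph V} {k : ℕ}
    (hD : D.IsRegular k) (n : ℕ) (v : V) : ∑ w, ((Matrix.of D.mult) ^ n) v w = k ^ n := by
  induction n with
  | zero => simp [Matrix.one_apply]
  | succ n ih =>
    simp only [pow_succ, Matrix.mul_apply]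
    rw [Finset.sum_comm]
    simp only [← Finset.mul_sum, Matrix.of_apply, hD.1, ← Finset.sum_mul, ih]

theorem IsRegular.card_mul_pow_le [Fintype V] [DecidableEq V] {D : MultiDigraph V} {k : ℕ}
    (hD : D.IsRegular k) (n : ℕ) :
    (Fintype.card V : ℝ) * k ^ n ≤ ∑ w, ∑ v, ‖(D.adjMatrix ^ n) v w‖ ^ 2 := by
  have hA : D.adjMatrix = (Matrix.of D.mult).map (Nat.castRingHom ℂ) := rfl
  rw [Finset.sum_comm, hA, ← Matrix.map_pow]
  have h : ∀ v, (k : ℝ) ^ n ≤ ∑ w, ‖(((Matrix.of D.mult) ^ n).map (Nat.castRingHom ℂ)) v w‖ ^ 2 := by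
    intro v
    have := hD.row_sum_pow n v
    calc (k : ℝ) ^ n = ∑ w, ((((Matrix.of D.mult) ^ n) v w : ℕ) : ℝ) := by exact_mod_cast this.symm
      _ ≤ _ := Finset.sum_le_sum fun w _ => by
        simp only [Matrix.map_apply, Nat.coe_castRingHom, Complex.norm_natCast]
        exact_mod_cast Nat.le_self_pow two_ne_zero _
  calc (Fintype.card V : ℝ) * k ^ n = ∑ _v : V, (k : ℝ) ^ n := by simp
    _ ≤ _ := Finset.sum_le_sum fun v _ => h v

theorem IsRegular.card_le_of_isRNormal [Fintype V] [DecidableEq V] {D : MultiDigraph V} {k m r : ℕ}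
    (hD : D.IsRegular k) (hk : 0 < k) (hconn : D.IsConnected) (hper : D.IsPeriodic m)
    (hnormal : D.IsRNormal r) {ρ δ : ℝ} (hρ0 : 0 ≤ ρ) (hρk : ρ ≤ k) (hδ : 0 < δ)
    (hρ : D.rho k ≤ ρ) (n : ℕ) :
    (Fintype.card V : ℝ) * k ^ n ≤ (m * r : ℕ) * (k ^ n) ^ 2
      + Fintype.card V * (powerBoundConst k δ r * (ρ + δ) ^ n) ^ 2 := by
  classical
  have := hconn.1
  have := hD.finite_periodGroup hk
  obtain ⟨U, hU, b, hb, hM⟩ := hnormal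
  set M := star U * D.adjMatrix * U with hMdef
  have hUM : D.adjMatrix * U = U * M := by
    rw [hMdef, ← Matrix.mul_assoc, ← Matrix.mul_assoc, Matrix.mem_unitaryGroup_iff.1 hU, one_mul]
  set u : V → EuclideanSpace ℂ V := fun w => WithLp.toLp 2 fun v => U v w with hu
  set S : ℕ → Submodule ℂ (EuclideanSpace ℂ V) := fun c => Submodule.span ℂ (u '' {w | b w = c}) with hS
  have huS : ∀ w, u w ∈ S (b w) := fun w => Submodule.subset_span ⟨w, rfl, rfl⟩
  have hinner : ∀ v w, inner ℂ (u v) (u w) = (1 : Matrix V V ℂ) v w := by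
    intro v w
    rw [← Matrix.mem_unitaryGroup_iff'.1 hU]
    simp [hu, PiLp.inner_apply, Matrix.mul_apply, Matrix.star_apply, mul_comm]
  have hnorm : ∀ w, ‖u w‖ = 1 := by
    intro w
    have := inner_self_eq_norm_sq_to_K (𝕜 := ℂ) (u w)
    rw [hinner, Matrix.one_apply_eq] at this
    have h2 : ‖u w‖ ^ 2 = 1 := Complex.ofReal_injective (by simpa using this.symm)
    exact (pow_eq_one_iff_of_nonneg (norm_nonneg _) two_ne_zero).1 h2
  have hortho : ∀ c d, c ≠ d → S c ⟂ S d := by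
    intro c d hcd
    rw [Submodule.isOrtho_span]
    rintro _ ⟨v, hv, rfl⟩ _ ⟨w, hw, rfl⟩
    rw [hinner, Matrix.one_apply_ne]
    rintro rfl
    exact hcd (hv.symm.trans hw)
  have hTu : ∀ w, D.adjOp (u w) = ∑ x, M x w • u x := by
    intro w
    ext v
    have := congrFun (congrFun hUM v) w
    rw [Matrix.mul_apply, Matrix.mul_apply] at this
    rw [adjOp_apply]
    simpa [hu, adjMatrix, mul_comm] using this
  have hinv : ∀ c, ∀ x ∈ S c, D.adjOp x ∈ S c := by
    intro c x hx
    have : S c ≤ (S c).comap D.adjOp := by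
      refine Submodule.span_le.2 ?_
      rintro _ ⟨w, hw, rfl⟩
      change D.adjOp (u w) ∈ S c
      rw [hTu]
      refine Submodule.sum_mem _ fun y _ => ?_
      by_cases h : b y = b w
      · rw [← show b w = c from hw, ← h]
        exact Submodule.smul_mem _ _ (huS y)
      · rw [hM y w h, zero_smul]
        exact Submodule.zero_mem _
    exact this hx
  have hrank : ∀ c, Module.finrank ℂ (S c) ≤ r := by
    intro c
    have : S c = Submodule.span ℂ (((Finset.univ.filter fun w => b w = c).image u : Finset _) : Set _) := by
      simp [hS]
    rw [this]
    exact (finrank_span_finset_le_card _).trans (Finset.card_image_le.trans (hb c))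
  -- The exceptional blocks, on which powers can grow like `k ^ n`.
  set P : ℕ → Prop := fun c => ∃ μ : ℂ, ‖μ‖ = k ∧ ∃ f ∈ S c, D.adjOp.HasEigenvector μ f with hP
  have hpow : ∀ w, ∑ v, ‖(D.adjMatrix ^ n * U) v w‖ ^ 2 = ‖(D.adjOp ^ n) (u w)‖ ^ 2 := by
    intro w
    rw [EuclideanSpace.norm_sq_eq]
    have : (D.adjOp ^ n) (u w) = WithLp.toLp 2 fun v => (D.adjMatrix ^ n * U) v w := by
      generalize n = l
      induction l with
      | zero => simp [hu]
      | succ l ih =>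
        rw [pow_succ', Module.End.mul_apply, ih]
        ext v
        rw [adjOp_apply, pow_succ', Matrix.mul_assoc]
        exact (Matrix.mul_apply (M := D.adjMatrix)).symm
    rw [this]
  have htriv : ∀ w, ‖(D.adjOp ^ n) (u w)‖ ≤ k ^ n := by
    intro w
    generalize n = l
    induction l with
    | zero => simp [hnorm]
    | succ l ih =>
      rw [pow_succ', Module.End.mul_apply, pow_succ']
      exact (hD.norm_adjOp_le hk _).trans (by gcongr)
  have hnontriv : ∀ w, ¬ P (b w) →
      ‖(D.adjOp ^ n) (u w)‖ ≤ powerBoundConst k δ r * (ρ + δ) ^ n := by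
    intro w hw
    have := norm_pow_apply_le_of_mem_invariant D.adjOp (hD.norm_adjOp_le hk) hρ0 hρk hδ (S (b w))
      (hinv _) (hrank _) (fun μ f hfS hf => (hD.norm_eigenvalue_le_rho hk
        (fun hμ => hw ⟨μ, hμ, f, hfS, hf⟩) hf).trans hρ) (u w) (huS w) n
    rwa [hnorm, mul_one] at this
  have hcard : (Finset.univ.filter fun w => P (b w)).card ≤ m * r := by
    set Q : Finset ℕ := (Finset.univ.filter fun w => P (b w)).image b with hQ
    have hQP : ∀ c : Q, P c := by
      rintro ⟨c, hc⟩
      obtain ⟨w, hw, rfl⟩ := Finset.mem_image.1 hc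
      exact (Finset.mem_filter.1 hw).2
    choose μ hμ f hfS hf using hQP
    -- Exceptional blocks inject into the period group through `μ / k`: two blocks sharing `μ` would
    -- contain proportional, yet orthogonal, eigenvectors.
    have hQm : Q.card ≤ m := by
      rw [← Nat.card_eq_finsetCard]
      refine (Nat.card_le_card_of_injective (fun c => (⟨_, hD.mk0_mem_periodGroup hk hconn (hμ c) (hf c)⟩ :
        D.periodGroup)) fun c d hcd => ?_).trans (hper.card_periodGroup_le hconn)
      have hk' : (k : ℂ) ≠ 0 := by exact_mod_cast hk.ne'
      have hμcd : μ c = μ d := by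
        have := congrArg (fun z : D.periodGroup => ((z : ℂˣ) : ℂ)) hcd
        exact (div_left_inj' hk').1 this
      by_contra hne
      have hf' := hf d
      rw [← hμcd] at hf'
      exact hD.inner_ne_zero_of_trivial hk hconn (hμ c) (hf c) hf'
        (Submodule.isOrtho_iff_inner_eq.1 (hortho c d (Subtype.coe_injective.ne hne)) _ (hfS c) _ (hfS d))
    calc _ ≤ Q.card * r := by
          rw [mul_comm]
          refine Finset.card_le_mul_card_image _ _ fun c _ => ?_
          refine (Finset.card_le_card ?_).trans (hb c)
          intro w hw
          rw [Finset.mem_filter] at hw ⊢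
          exact ⟨Finset.mem_univ _, hw.2⟩
      _ ≤ m * r := Nat.mul_le_mul_right _ hQm
  calc (Fintype.card V : ℝ) * k ^ n ≤ ∑ w, ∑ v, ‖(D.adjMatrix ^ n) v w‖ ^ 2 := hD.card_mul_pow_le n
    _ = ∑ w, ‖(D.adjOp ^ n) (u w)‖ ^ 2 := by
      rw [← Matrix.sum_norm_sq_mul_unitary _ U hU]
      exact Finset.sum_congr rfl fun w _ => hpow w
    _ ≤ ∑ w, ((if P (b w) then ((k : ℝ) ^ n) ^ 2 else 0)
          + (powerBoundConst k δ r * (ρ + δ) ^ n) ^ 2) := by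
      refine Finset.sum_le_sum fun w _ => ?_
      by_cases h : P (b w)
      · rw [if_pos h]
        have := htriv w
        exact (pow_le_pow_left₀ (norm_nonneg _) this 2).trans (le_add_of_nonneg_right (sq_nonneg _))
      · rw [if_neg h, zero_add]
        exact pow_le_pow_left₀ (norm_nonneg _) (hnontriv w h) 2
    _ ≤ _ := by
      rw [Finset.sum_add_distrib, ← Finset.sum_filter, Finset.sum_const, Finset.sum_const,
        nsmul_eq_mul, nsmul_eq_mul, Finset.card_univ]
      have : ((Finset.univ.filter fun w => P (b w)).card : ℝ) ≤ (m * r : ℕ) := by exact_mod_cast hcard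
      gcongr

/-! ### Finiteness of the family -/

theorem finite_of_card_le {k N : ℕ} {ι : Type*} {V : ι → Type*} [∀ i, Fintype (V i)]
    (D : ∀ i, MultiDigraph (V i)) (hiso : Pairwise fun i j => IsEmpty (Iso (D i) (D j)))
    (hreg : ∀ i, (D i).IsRegular k) (hN : ∀ i, Fintype.card (V i) ≤ N) : Finite ι := by
  have hmult : ∀ i v w, (D i).mult v w < k + 1 := fun i v w =>
    Nat.lt_succ_of_le ((Finset.single_le_sum (f := fun w => (D i).mult v w)
      (fun _ _ => Nat.zero_le _) (Finset.mem_univ w)).trans ((hreg i).1 v).le)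
  let F : ι → Σ n : Fin (N + 1), (Fin n → Fin n → Fin (k + 1)) := fun i =>
    ⟨⟨Fintype.card (V i), Nat.lt_succ_of_le (hN i)⟩, fun a b =>
      ⟨(D i).mult ((Fintype.equivFin (V i)).symm a) ((Fintype.equivFin (V i)).symm b), hmult _ _ _⟩⟩
  -- Stated for a general `x`, so that `F i = F j` yields two labellings by the same `Fin x.1`
  -- without casts.
  have hF : ∀ (x : Σ n : Fin (N + 1), (Fin n → Fin n → Fin (k + 1))) (i : ι), F i = x →
      ∃ e : V i ≃ Fin x.1, ∀ v w, (x.2 (e v) (e w) : ℕ) = (D i).mult v w := by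
    rintro x i rfl
    exact ⟨Fintype.equivFin (V i), fun v w => by simp [F]⟩
  refine Finite.of_injective F fun i j hij => ?_
  by_contra hne
  obtain ⟨e, he⟩ := hF (F j) i hij
  obtain ⟨e', he'⟩ := hF (F j) j rfl
  exact (hiso hne).false ⟨e.trans e'.symm, fun v w => by rw [← he', ← he]; simp⟩

end MultiDigraph

theorem theorem4p3 (k m : ℕ) (hk : 2 ≤ k) (hm : 1 ≤ m) (ε : ℝ) (hε : 0 < ε)
    {ι : Type*} {V : ι → Type*} [∀ i, Fintype (V i)] [∀ i, DecidableEq (V i)]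
    (D : ∀ i, MultiDigraph (V i))
    (hiso : Pairwise fun i j => IsEmpty (MultiDigraph.Iso (D i) (D j)))
    (hconn : ∀ i, (D i).IsConnected)
    (hreg : ∀ i, (D i).IsRegular k)
    (hper : ∀ i, (D i).IsPeriodic m)
    (hnormal : MultiDigraph.IsAlmostNormalFamily D)
    (hrho : ∀ i, (D i).rho k ≤ √k - ε) :
    Finite ι := by
  rcases isEmpty_or_nonempty ι with _ | ⟨⟨i₀⟩⟩
  · infer_instance
  have hk0 : 0 < k := by lia
  have hk1 : (1 : ℝ) ≤ k := by exact_mod_cast hk0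
  obtain ⟨r, hr⟩ := hnormal
  -- A member of the family is needed here: for large `ε` the bound is negative and the family is
  -- empty.
  have hρ0 : 0 ≤ √(k : ℝ) - ε := ((D i₀).rho_nonneg k).trans (hrho i₀)
  have hρk : √(k : ℝ) - ε ≤ k := by
    have : √(k : ℝ) ≤ k := Real.sqrt_le_self_iff.2 (Or.inr hk1)
    linarith
  -- With `δ = ε / 2` the growth rate `σ` stays below `√k`; neither `C` nor `σ` depends on the
  -- digraph, so one `n` serves all.
  set C := powerBoundConst k (ε / 2) r
  set σ := √(k : ℝ) - ε + ε / 2 with hσ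
  have hσ0 : 0 ≤ σ := by linarith
  have hσk : σ ^ 2 < k := by
    rw [← Real.lt_sqrt hσ0]
    linarith
  have hq : Filter.Tendsto (fun n : ℕ => C ^ 2 * (σ ^ 2 / k) ^ n) Filter.atTop (nhds (C ^ 2 * 0)) :=
    (tendsto_pow_atTop_nhds_zero_of_lt_one (by positivity)
      ((div_lt_one (by linarith)).2 hσk)).const_mul _
  rw [mul_zero] at hq
  obtain ⟨n, hn⟩ := (hq.eventually_lt_const (show (0 : ℝ) < 1 / 2 by norm_num)).exists
  have hkn : (0 : ℝ) < (k : ℝ) ^ n := by positivity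
  have hn' : (C * σ ^ n) ^ 2 ≤ k ^ n / 2 := by
    have e : (C * σ ^ n) ^ 2 = C ^ 2 * (σ ^ 2 / k) ^ n * k ^ n := by
      rw [div_pow, mul_pow, ← pow_mul, ← pow_mul, mul_comm n 2]
      field_simp
    rw [e]
    nlinarith
  refine MultiDigraph.finite_of_card_le (N := 2 * (m * r) * k ^ n) D hiso hreg fun i => ?_
  have h := (hreg i).card_le_of_isRNormal hk0 (hconn i) (hper i) (hr i) hρ0 hρk
    (half_pos hε) (hrho i) n
  have h2 : (Fintype.card (V i) : ℝ) * (C * σ ^ n) ^ 2 ≤ Fintype.card (V i) * (k ^ n / 2) := by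
    gcongr
  have h3 : (Fintype.card (V i) : ℝ) * k ^ n ≤ (2 * (m * r : ℕ) * k ^ n) * k ^ n := by
    nlinarith
  exact_mod_cast le_of_mul_le_mul_right h3 hkn
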